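/- Let $m,n\ge 3$ be integers. Consider an $m\times n$ board with integer entries whose opposite sides are glued to form a torus, so that rows are indexed modulo $m$ and columns modulo $n$. Two distinct cells are neighbours if they share an edge or a vertex on the torus, i.e. if their row indices differ by $-1$, $0$ or $1$ modulo $m$ and their column indices differ by $-1$, $0$ or $1$ modulo $n$. The board has the neighbour-sum property if the entry of each cell equals the sum of the entries of its neighbours, and it is non-trivial if not all of its entries are zero. Then a non-trivial $m\times n$ toroidal board with the neighbour-sum property exists if and only if either $4\mid m$ and $6\mid n$, or $6\mid m$ and $4\mid n$. -/

import Mathlib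

/-- The toroidal king's graph: the cells of the `m × n` board with opposite sides glued are the
pairs `(i, j)` with `i` modulo `m` and `j` modulo `n`; two distinct cells are neighbours when both
their row indices and their column indices differ by `-1`, `0` or `1` (cyclically), that is, when
the cells share an edge or a vertex on the torus. -/
def torusKingGraph (m n : ℕ) : SimpleGraph (ZMod m × ZMod n) where
  Adj p q := p ≠ q ∧ (p.1 - q.1 = -1 ∨ p.1 - q.1 = 0 ∨ p.1 - q.1 = 1) ∧
    (p.2 - q.2 = -1 ∨ p.2 - q.2 = 0 ∨ p.2 - q.2 = 1)
  symm := ⟨by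
    rintro p q ⟨h, h1, h2⟩
    refine ⟨h.symm, ?_, ?_⟩
    · rw [← neg_sub p.1 q.1]
      rcases h1 with h1 | h1 | h1 <;> simp [h1]
    · rw [← neg_sub p.2 q.2]
      rcases h2 with h2 | h2 | h2 <;> simp [h2]⟩
  loopless := ⟨fun _ h => h.1 rfl⟩

instance torusKingGraphDecidableAdj (m n : ℕ) : DecidableRel (torusKingGraph m n).Adj :=
  fun p q => inferInstanceAs (Decidable (p ≠ q ∧
    (p.1 - q.1 = -1 ∨ p.1 - q.1 = 0 ∨ p.1 - q.1 = 1) ∧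
    (p.2 - q.2 = -1 ∨ p.2 - q.2 = 0 ∨ p.2 - q.2 = 1)))

/-- An integer-filled `m × n` toroidal board has the neighbour-sum property if the entry of every
cell is the sum of the entries of its neighbouring cells. -/
def HasTorusNeighbourSum {m n : ℕ} [NeZero m] [NeZero n]
    (X : Matrix (ZMod m) (ZMod n) ℤ) : Prop :=
  ∀ p : ZMod m × ZMod n, X p.1 p.2 = ∑ q ∈ (torusKingGraph m n).neighborFinset p, X q.1 q.2

/-! A two-dimensional Fourier transform turns a non-trivial board into roots of unity `x`, `y` of
orders dividing `m`, `n` with `(1 + x + x⁻¹) * (1 + y + y⁻¹) = 2`. The arithmetic core,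
`two_dvd_or_two_dvd_of_mul_eq_two`, shows that `2` divides one factor among the algebraic integers.
Frobenius modulo `2` makes a factor coprime to `2` unless the odd part of the order is `3`; the
remaining cases compare `x ^ 3 - 1` and `y ^ 3 - 1` with `i - 1`, where `i ^ 2 = -1`. A bound on
conjugates (`one_add_add_inv_eq_two`) then makes that factor equal to `2` and the other `1`, which
forces orders `6` and `4`. Conversely, products of cosine waves of periods `4` and `6` are boards.
-/

/-! ### Divisibility by `2` for sums of roots of unity -/

/-- Modulo `2`, raising to a power `2 ^ k` is additive on `1 + x + y`. -/
lemma two_dvd_pow_two_pow_sub {R : Type*} [CommRing R] (x y : R) (k : ℕ) :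
    (2 : R) ∣ (1 + x + y) ^ 2 ^ k - (1 + x ^ 2 ^ k + y ^ 2 ^ k) := by
  induction k with
  | zero => simp
  | succ k ih =>
    obtain ⟨c, hc⟩ := ih
    simp only [pow_succ 2 k, pow_mul]
    generalize x ^ 2 ^ k = a at *
    generalize y ^ 2 ^ k = b at *
    rw [sub_eq_iff_eq_add.1 hc]
    exact ⟨2 * c ^ 2 + 2 * c * (1 + a + b) + (a + b + a * b), by ring⟩

lemma isCoprime_natCast_two_of_odd {R : Type*} [CommRing R] {r : ℕ} (hr : Odd r) :
    IsCoprime (r : R) 2 := by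
  obtain ⟨k, rfl⟩ := hr
  exact ⟨1, -k, by push_cast; ring⟩

/-- For a root of unity `x`, either `1 + x + x⁻¹` is coprime to `2`, or `x ^ 3` has order a power
of `2` and `x - 1` is coprime to `2`. -/
lemma isCoprime_one_add_add_two_or {R : Type*} [CommRing R] [IsDomain R] {x x' : R}
    (hx : x * x' = 1) {m : ℕ} (hm : m ≠ 0) (hxm : x ^ m = 1) :
    IsCoprime (1 + x + x') 2 ∨ IsCoprime (x - 1) 2 ∧ ∃ k : ℕ, (x ^ 3) ^ 2 ^ k = 1 := by
  obtain ⟨a, r, hr, rfl⟩ := Nat.exists_eq_two_pow_mul_odd hm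
  obtain ⟨c, hc⟩ := two_dvd_pow_two_pow_sub x x' a
  have hz : x ^ 2 ^ a * x' ^ 2 ^ a = 1 := by rw [← mul_pow, hx, one_pow]
  have hxz : x - 1 ∣ x ^ 2 ^ a - 1 := sub_one_dvd_pow_sub_one x _
  rw [pow_mul] at hxm
  have hs : (x ^ 3) ^ 2 ^ a = (x ^ 2 ^ a) ^ 3 := by rw [← pow_mul, ← pow_mul, mul_comm]
  generalize x ^ 2 ^ a = z at *
  generalize x' ^ 2 ^ a = z' at *
  have key : IsCoprime (1 + z + z') 2 → IsCoprime (1 + x + x') 2 := fun h => by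
    rw [← IsCoprime.pow_left_iff (m := 2 ^ a) (by positivity), sub_eq_iff_eq_add.1 hc]
    exact (IsCoprime.mul_add_left_left_iff).2 h
  by_cases h1 : z = 1
  · left
    apply key
    have h2 : z' = 1 := by simpa [h1] using hz
    rw [h1, h2]
    exact ⟨1, -1, by norm_num⟩
  by_cases h3 : z ^ 3 = 1
  · right
    have h4 : 1 + z + z ^ 2 = 0 := by
      have : (z - 1) * (1 + z + z ^ 2) = 0 := by linear_combination h3
      exact (mul_eq_zero.1 this).resolve_left (sub_ne_zero.2 h1)
    refine ⟨IsCoprime.of_isCoprime_of_dvd_left ?_ hxz, a, hs.trans h3⟩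
    -- `(z - 1) * (z + 2) = -3` for a primitive cube root of unity.
    exact ⟨-(z + 2), -1, by linear_combination -h4⟩
  · left
    apply key
    have h4 : z ^ 3 - 1 ∣ (r : R) := sub_one_dvd_natCast_of_pow_eq_one
      (by rw [← pow_mul, mul_comm, pow_mul, hxm, one_pow]) h3
    refine (isCoprime_natCast_two_of_odd hr).of_isCoprime_of_dvd_left (dvd_trans ?_ h4)
    exact ⟨(z - 1) * z, by linear_combination (1 - z) * hz⟩

/-- An element of order at least `8` has a primitive eighth root of unity among its powers, by
induction through `s ^ 2`. -/
lemma eq_of_pow_two_pow_eq_one {R : Type*} [CommRing R] [IsDomain R] (a : ℕ) :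
    ∀ s : R, s ^ 2 ^ a = 1 → s = 1 ∨ s = -1 ∨ s ^ 2 = -1 ∨ ∃ k : ℕ, (s ^ k) ^ 4 = -1 := by
  induction a with
  | zero => intro s hs; left; simpa using hs
  | succ a ih =>
    intro s hs
    rw [pow_succ', pow_mul] at hs
    rcases ih _ hs with h | h | h | ⟨k, h⟩
    · rcases mul_self_eq_one_iff.1 ((sq _).symm.trans h) with h | h <;> simp [h]
    · simp [h]
    · exact .inr (.inr (.inr ⟨1, by rw [pow_one]; linear_combination h⟩))
    · exact .inr (.inr (.inr ⟨2 * k, by rw [pow_mul, h]⟩))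

/-- The possibilities for a root of unity `x` such that `1 + x + x⁻¹` is nonzero and not coprime
to `2`. -/
lemma two_dvd_one_add_add_or {R : Type*} [CommRing R] [IsDomain R] (h2 : ¬ IsUnit (2 : R))
    {x x' : R} (hx : x * x' = 1) (hu : 1 + x + x' ≠ 0) (hc : IsCoprime (x - 1) 2)
    (hs : ∃ k : ℕ, (x ^ 3) ^ 2 ^ k = 1) :
    2 ∣ 1 + x + x' ∨ x ^ 4 - x ^ 2 + 1 = 0 ∧ (x ^ 3) ^ 2 = -1 ∨
      ∃ e : R, e ^ 4 = -1 ∧ (x ^ 3 - 1) * (e + 1) ∣ e ^ 2 - 1 := by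
  have hx1 : x ≠ 1 := by
    rintro rfl
    rw [sub_self, isCoprime_zero_left] at hc
    exact h2 hc
  -- Excludes `x = -1` and `x ^ 2 = -1`, where `x - 1 = -2` and `(x - 1) ^ 2 = -2 * x`.
  have hxn : ∀ n : ℕ, (2 : R) ∣ (x - 1) ^ n → False := fun n h =>
    h2 ((hc.pow_left (m := n)).symm.isUnit_of_dvd' dvd_rfl h)
  obtain ⟨k, hk⟩ := hs
  rcases eq_of_pow_two_pow_eq_one k _ hk with h | h | h | ⟨l, h⟩
  · exfalso
    have h1 : (x - 1) * (x * (1 + x + x')) = 0 := by linear_combination h + (x - 1) * hx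
    rcases mul_eq_zero.1 h1 with h1 | h1
    · exact hx1 (sub_eq_zero.1 h1)
    · exact (mul_ne_zero (left_ne_zero_of_mul_eq_one hx) hu) h1
  · left
    have h1 : (x + 1) * (x ^ 2 - x + 1) = 0 := by linear_combination h
    rcases mul_eq_zero.1 h1 with h1 | h1
    · exact (hxn 1 ⟨-1, by linear_combination h1⟩).elim
    · exact ⟨1, by linear_combination x' * h1 + (1 - x) * hx⟩
  · right; left
    refine ⟨?_, h⟩
    have h1 : (x ^ 2 + 1) * (x ^ 4 - x ^ 2 + 1) = 0 := by linear_combination h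
    rcases mul_eq_zero.1 h1 with h1 | h1
    · exact (hxn 2 ⟨-x, by linear_combination h1⟩).elim
    · exact h1
  · right; right
    refine ⟨_, h, ?_⟩
    obtain ⟨c, hc⟩ := sub_one_dvd_pow_sub_one (x ^ 3) l
    exact ⟨c, by linear_combination ((x ^ 3) ^ l + 1) * hc⟩

/-- If `i` and `j` are square roots of `-1`, then `(i - 1) * (j - 1)` is associated to `2`. -/
lemma exists_mul_sub_one_mul_sub_one_eq {R : Type*} [CommRing R] [IsDomain R] {i j : R}
    (hi : i ^ 2 = -1) (hj : j ^ 2 = -1) : ∃ u : R, IsUnit u ∧ (i - 1) * (j - 1) = 2 * u := by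
  have h : (j - i) * (j + i) = 0 := by linear_combination hj - hi
  rcases mul_eq_zero.1 h with h | h
  · have : i * -i = 1 := by linear_combination -hi
    exact ⟨-i, (IsUnit.of_mul_eq_one i (by rw [mul_comm, this])), by linear_combination (i - 1) * h + hi⟩
  · exact ⟨1, isUnit_one, by linear_combination (i - 1) * h - hi⟩

/-- `2` divides `(e + 1) ^ 4`, since `e ^ 4 + 1` vanishes in the expansion. -/
lemma not_isUnit_add_one_of_pow_four {R : Type*} [CommRing R] (h2 : ¬ IsUnit (2 : R)) {e : R}
    (he : e ^ 4 = -1) : ¬ IsUnit (e + 1) := fun h => by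
  refine h2 (isUnit_of_dvd_unit ?_ (h.pow 4))
  exact ⟨2 * e ^ 3 + 3 * e ^ 2 + 2 * e, by linear_combination he⟩

/-- If `x ^ 3 - 1` and `y ^ 3 - 1` divide `i - 1` and `j - 1`, the cofactor is a unit as soon as
`(1 + x + x⁻¹) * (1 + y + y⁻¹) = 2`. -/
lemma isUnit_of_mul_dvd_sub_one {R : Type*} [CommRing R] [IsDomain R] [CharZero R]
    {x x' y y' i j d : R}
    (hx : x * x' = 1) (hy : y * y' = 1) (h : (1 + x + x') * (1 + y + y') = 2)
    (hi : i ^ 2 = -1) (hj : j ^ 2 = -1) (hxi : (x ^ 3 - 1) * d ∣ i - 1) (hyj : y ^ 3 - 1 ∣ j - 1) :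
    IsUnit d := by
  obtain ⟨u, hu, hij⟩ := exists_mul_sub_one_mul_sub_one_eq hi hj
  obtain ⟨c, hc⟩ := hxi
  obtain ⟨b, hb⟩ := hyj
  refine isUnit_of_dvd_unit ⟨c * b * (x - 1) * x * ((y - 1) * y), ?_⟩ hu
  -- The hypothesis `h` gives `(x ^ 3 - 1) * (y ^ 3 - 1) = 2 * ((x - 1) * x * ((y - 1) * y))`, so
  -- the factor `2` cancels against the one in `(i - 1) * (j - 1)`.
  refine mul_left_cancel₀ (two_ne_zero (α := R)) ?_
  have h1 : x ^ 3 - 1 = (x - 1) * x * (1 + x + x') := by linear_combination (1 - x) * hx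
  have h3 : y ^ 3 - 1 = (y - 1) * y * (1 + y + y') := by linear_combination (1 - y) * hy
  rw [← hij, hc, hb, h1, h3]
  linear_combination d * c * b * (x - 1) * x * ((y - 1) * y) * h

/-- If `(1 + x + x⁻¹) * (1 + y + y⁻¹) = 2` with roots of unity `x` and `y`, then one of the two
factors is divisible by `2`. -/
theorem two_dvd_or_two_dvd_of_mul_eq_two {R : Type*} [CommRing R] [IsDomain R] [CharZero R]
    (h2 : ¬ IsUnit (2 : R)) {x x' y y' : R} (hx : x * x' = 1) (hy : y * y' = 1) {m n : ℕ}
    (hm : m ≠ 0) (hn : n ≠ 0) (hxm : x ^ m = 1) (hyn : y ^ n = 1)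
    (h : (1 + x + x') * (1 + y + y') = 2) : 2 ∣ 1 + x + x' ∨ 2 ∣ 1 + y + y' := by
  have hu : 1 + x + x' ≠ 0 := left_ne_zero_of_mul (h.trans_ne two_ne_zero)
  have hv : 1 + y + y' ≠ 0 := right_ne_zero_of_mul (h.trans_ne two_ne_zero)
  have h' : (1 + y + y') * (1 + x + x') = 2 := by rw [mul_comm, h]
  rcases isCoprime_one_add_add_two_or hx hm hxm with hc | ⟨hcx, hsx⟩
  · exact .inr (hc.symm.dvd_of_dvd_mul_left h.symm.dvd)
  rcases isCoprime_one_add_add_two_or hy hn hyn with hc | ⟨hcy, hsy⟩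
  · exact .inl (hc.symm.dvd_of_dvd_mul_left h'.symm.dvd)
  have hsq : ∀ {e : R}, e ^ 4 = -1 → (e ^ 2) ^ 2 = -1 := fun he => by rw [← pow_mul, he]
  rcases two_dvd_one_add_add_or h2 hx hu hcx hsx with hd | ⟨hx4, hx6⟩ | ⟨e, he, hde⟩
  · exact .inl hd
  · rcases two_dvd_one_add_add_or h2 hy hv hcy hsy with hd | ⟨hy4, hy6⟩ | ⟨f, hf, hdf⟩
    · exact .inr hd
    · exfalso
      -- Both orders are `12`: the factors are `1 ± √3`, whose products are `-2` and `4 ± 2√3`,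
      -- never `2`.
      have hc : (x + x') ^ 2 = 3 := by
        linear_combination x' ^ 2 * hx4 + (2 - x ^ 3 * x' - x ^ 2 + x * x' + 1) * hx
      have hd : (y + y') ^ 2 = 3 := by
        linear_combination y' ^ 2 * hy4 + (2 - y ^ 3 * y' - y ^ 2 + y * y' + 1) * hy
      generalize hc0 : x + x' = c at *
      generalize hd0 : y + y' = d at *
      rw [add_assoc, add_assoc, hc0, hd0] at h
      have hcd : (d - c) * (d + c) = 0 := by linear_combination hd - hc
      rcases mul_eq_zero.1 hcd with hcd | hcd
      · have : 2 * (c + 1) = 0 := by linear_combination h - (1 + c) * hcd - hc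
        have hc1 : c + 1 = 0 := (mul_eq_zero.1 this).resolve_left two_ne_zero
        have : (2 : R) = 0 := by linear_combination (c - 1) * hc1 - hc
        exact two_ne_zero this
      · have : (4 : R) = 0 := by linear_combination (1 + c) * hcd - h - hc
        exact OfNat.ofNat_ne_zero 4 this
    · exact (not_isUnit_add_one_of_pow_four h2 hf
        (isUnit_of_mul_dvd_sub_one hy hx h' (hsq hf) hx6 hdf dvd_rfl)).elim
  · have hc := not_isUnit_add_one_of_pow_four h2 he
    rcases two_dvd_one_add_add_or h2 hy hv hcy hsy with hd | ⟨hy4, hy6⟩ | ⟨f, hf, hdf⟩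
    · exact .inr hd
    · exact (hc (isUnit_of_mul_dvd_sub_one hx hy h (hsq he) hy6 hde dvd_rfl)).elim
    · exact (hc (isUnit_of_mul_dvd_sub_one hx hy h (hsq he) (hsq hf) hde
        (dvd_of_mul_right_dvd hdf))).elim

/-! ### Bounding conjugates and determining the orders -/

/-- An algebraic integer in a number field all of whose conjugates have absolute value less than
`1` is zero. -/
lemma eq_zero_of_isIntegral_of_norm_embedding_lt_one {K : Type*} [Field K] [NumberField K] {t : K}
    (ht : IsIntegral ℤ t) (h : ∀ σ : K →ₐ[ℚ] ℂ, ‖σ t‖ < 1) : t = 0 := by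
  classical
  obtain ⟨a, ha⟩ := IsIntegrallyClosed.isIntegral_iff.1 (Algebra.isIntegral_norm ℚ ht)
  have h1 := Algebra.norm_eq_prod_embeddings ℚ ℂ t
  have h2 : ‖algebraMap ℚ ℂ (Algebra.norm ℚ t)‖ < 1 := by
    rw [h1, norm_prod]
    -- Some embedding must exist, as an empty product would be `1`.
    let σ : K →ₐ[ℚ] ℂ := IsAlgClosed.lift
    rw [← Finset.mul_prod_erase _ _ (Finset.mem_univ σ)]
    refine mul_lt_one_of_nonneg_of_lt_one_left (norm_nonneg _) (h σ) ?_
    exact Finset.prod_le_one (fun _ _ => norm_nonneg _) fun τ _ => (h τ).le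
  rw [← ha] at h2
  have h3 : |a| < 1 := by
    have : ‖(a : ℂ)‖ < 1 := by simpa using h2
    rw [Complex.norm_intCast] at this
    exact_mod_cast this
  rw [Int.abs_lt_one_iff.1 h3, map_zero] at ha
  exact Algebra.norm_eq_zero_iff.1 ha.symm

/-- If `y` is a root of unity and `2` divides the nonzero number `1 + y + y⁻¹` in the ring of
algebraic integers, then `1 + y + y⁻¹ = 2`. -/
lemma one_add_add_inv_eq_two {y : ℂ} {n : ℕ} (hn : n ≠ 0) (hy : y ^ n = 1)
    (hv : 1 + y + y⁻¹ ≠ 0) (hw : IsIntegral ℤ ((1 + y + y⁻¹) / 2)) : 1 + y + y⁻¹ = 2 := by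
  have hy0 : y ≠ 0 := by rintro rfl; simp [hn] at hy
  have hyQ : IsIntegral ℚ y := IsIntegral.of_pow (Nat.pos_of_ne_zero hn) (hy ▸ isIntegral_one)
  have := IntermediateField.adjoin.finiteDimensional hyQ
  let K := IntermediateField.adjoin ℚ {y}
  have : NumberField K := { to_finiteDimensional := this }
  let g : K := IntermediateField.AdjoinSimple.gen ℚ y
  have hg : (algebraMap K ℂ) g = y := IntermediateField.AdjoinSimple.algebraMap_gen ℚ y
  have hinj : Function.Injective (algebraMap K ℂ) := (algebraMap K ℂ).injective
  have hg0 : g ≠ 0 := fun h => hy0 (by rw [← hg, h, map_zero])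
  have hgn : g ^ n = 1 := hinj (by rw [map_pow, hg, hy, map_one])
  have hwK : IsIntegral ℤ ((1 + g + g⁻¹) / 2) := by
    rw [← isIntegral_algebraMap_iff (B := ℂ) hinj]
    simpa only [map_div₀, map_add, map_one, map_inv₀, hg, map_ofNat] using hw
  -- With `w` half the sum, conjugates of `w` may have absolute value up to `3 / 2`, but those of `w
  -- * (w - 1)` are at most `3 / 4`.
  have ht := (hwK.mul (hwK.sub isIntegral_one))
  have h0 := eq_zero_of_isIntegral_of_norm_embedding_lt_one ht fun σ => by
    have h1 : ‖σ g‖ = 1 :=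
      Complex.norm_eq_one_of_pow_eq_one (by rw [← map_pow, hgn, map_one]) hn
    have h2 : (1 + g + g⁻¹) / 2 * ((1 + g + g⁻¹) / 2 - 1) = (g ^ 2 + 1 + (g⁻¹) ^ 2) / 4 := by
      field_simp; ring
    rw [h2, map_div₀, norm_div]
    have h3 : ‖σ (g ^ 2 + 1 + (g⁻¹) ^ 2)‖ ≤ 3 := by
      simp only [map_add, map_pow, map_inv₀, map_one]
      refine norm_add₃_le.trans ?_
      simp [h1]; norm_num
    have h4 : ‖σ (4 : K)‖ = 4 := by rw [map_ofNat]; norm_num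
    rw [h4]; linarith
  have h5 := congrArg (algebraMap K ℂ) h0
  simp only [map_mul, map_sub, map_div₀, map_add, map_one, map_inv₀, hg, map_zero,
    map_ofNat] at h5
  rcases mul_eq_zero.1 h5 with h5 | h5
  · exact absurd ((div_eq_zero_iff.1 h5).resolve_right two_ne_zero) hv
  · linear_combination 2 * h5

lemma not_isUnit_two_integralClosure : ¬ IsUnit (2 : integralClosure ℤ ℂ) := fun h => by
  obtain ⟨b, hb⟩ := isUnit_iff_exists_inv.1 h
  have h1 : (2 : ℂ) * b = 1 := congrArg Subtype.val hb
  have h2 : (b : ℂ) = algebraMap ℚ ℂ (1 / 2) := by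
    rw [eq_div_of_mul_eq two_ne_zero ((mul_comm _ _).trans h1)]; simp
  have h3 : IsIntegral ℤ (1 / 2 : ℚ) := by
    rw [← isIntegral_algebraMap_iff (B := ℂ) (algebraMap ℚ ℂ).injective, ← h2]
    exact b.2
  obtain ⟨a, ha⟩ := IsIntegrallyClosed.isIntegral_iff.1 h3
  have h4 : (2 : ℚ) * a = 1 := by simp at ha; rw [ha]; norm_num
  have h5 : 2 * a = 1 := by exact_mod_cast h4
  omega

/-- The orders of the roots of unity with `1 + x + x⁻¹ = 1` and `1 + y + y⁻¹ = 2`. -/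
lemma four_dvd_and_six_dvd {x y : ℂ} {m n : ℕ} (hx0 : x ≠ 0) (hy0 : y ≠ 0) (hxm : x ^ m = 1)
    (hyn : y ^ n = 1) (hx : 1 + x + x⁻¹ = 1) (hy : 1 + y + y⁻¹ = 2) : 4 ∣ m ∧ 6 ∣ n := by
  have hx2 : x ^ 2 = -1 := by
    linear_combination x * hx - mul_inv_cancel₀ hx0
  have hy2 : y ^ 2 = y - 1 := by
    linear_combination y * hy - mul_inv_cancel₀ hy0
  have hy3 : y ^ 3 = -1 := by linear_combination (y + 1) * hy2
  constructor
  · have : orderOf x = 4 := orderOf_eq_prime_pow (p := 2) (n := 1)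
      (by rw [pow_one, hx2]; norm_num) (by linear_combination (x ^ 2 - 1) * hx2)
    exact this ▸ orderOf_dvd_of_pow_eq_one hxm
  · have : orderOf y = 6 := by
      rw [orderOf_eq_iff (by norm_num)]
      refine ⟨by rw [pow_mul y 3 2, hy3]; norm_num, fun k hk hk0 h => ?_⟩
      have hy1 : y ≠ 1 := by rintro rfl; norm_num at hy3
      have hym : y ≠ -1 := by rintro rfl; norm_num at hy2
      interval_cases k
      · exact hy1 (by simpa using h)
      · rcases mul_self_eq_one_iff.1 ((sq y).symm.trans h) with h | h
        · exact hy1 h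
        · exact hym h
      · rw [hy3] at h; norm_num at h
      · exact hym (by linear_combination y * hy3 - h)
      · exact hy1 (by linear_combination -y * h + (y ^ 3 - 1) * hy3)
    exact this ▸ orderOf_dvd_of_pow_eq_one hyn

/-- The solutions of `(1 + x + x⁻¹) * (1 + y + y⁻¹) = 2` in complex roots of unity. -/
theorem dvd_of_mul_one_add_add_inv_eq_two {x y : ℂ} {m n : ℕ} (hm : m ≠ 0) (hn : n ≠ 0)
    (hxm : x ^ m = 1) (hyn : y ^ n = 1) (h : (1 + x + x⁻¹) * (1 + y + y⁻¹) = 2) :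
    (4 ∣ m ∧ 6 ∣ n) ∨ (6 ∣ m ∧ 4 ∣ n) := by
  have hx0 : x ≠ 0 := by rintro rfl; simp [hm] at hxm
  have hy0 : y ≠ 0 := by rintro rfl; simp [hn] at hyn
  have hint : ∀ {z : ℂ} {k : ℕ}, k ≠ 0 → z ^ k = 1 → IsIntegral ℤ z := fun hk hz =>
    IsIntegral.of_pow (Nat.pos_of_ne_zero hk) (hz ▸ isIntegral_one)
  let X : integralClosure ℤ ℂ := ⟨x, hint hm hxm⟩
  let X' : integralClosure ℤ ℂ := ⟨x⁻¹, hint hm (by rw [inv_pow, hxm, inv_one])⟩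
  let Y : integralClosure ℤ ℂ := ⟨y, hint hn hyn⟩
  let Y' : integralClosure ℤ ℂ := ⟨y⁻¹, hint hn (by rw [inv_pow, hyn, inv_one])⟩
  have hdvd := two_dvd_or_two_dvd_of_mul_eq_two not_isUnit_two_integralClosure
    (x := X) (x' := X') (y := Y) (y' := Y') (Subtype.ext (mul_inv_cancel₀ hx0))
    (Subtype.ext (mul_inv_cancel₀ hy0)) hm hn (Subtype.ext hxm) (Subtype.ext hyn) (Subtype.ext h)
  rcases hdvd with ⟨c, hc⟩ | ⟨c, hc⟩
  · have hc' : 1 + x + x⁻¹ = 2 * c := congrArg Subtype.val hc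
    have hx : 1 + x + x⁻¹ = 2 := one_add_add_inv_eq_two hm hxm
      (left_ne_zero_of_mul (h.trans_ne two_ne_zero)) (by
        rw [hc', mul_div_cancel_left₀ _ two_ne_zero]; exact c.2)
    rw [hx] at h
    exact .inr (four_dvd_and_six_dvd hy0 hx0 hyn hxm (by linear_combination h / 2) hx).symm
  · have hc' : 1 + y + y⁻¹ = 2 * c := congrArg Subtype.val hc
    have hy : 1 + y + y⁻¹ = 2 := one_add_add_inv_eq_two hn hyn
      (right_ne_zero_of_mul (h.trans_ne two_ne_zero)) (by
        rw [hc', mul_div_cancel_left₀ _ two_ne_zero]; exact c.2)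
    rw [hy] at h
    exact .inl (four_dvd_and_six_dvd hx0 hy0 hxm hyn (by linear_combination h / 2) hy)

/-! ### Fourier analysis of the board -/

/-- Translations become multiplication by character values. Values in a general `E` let this apply
both to whole rows and to single entries. -/
lemma dft_sub_one_add_add_add_one {N : ℕ} [NeZero N] {E : Type*} [AddCommGroup E] [Module ℂ E]
    (F : ZMod N → E) (k : ZMod N) :
    ZMod.dft (fun i => F (i - 1) + F i + F (i + 1)) k =
      (1 + ZMod.stdAddChar k + (ZMod.stdAddChar k)⁻¹) • ZMod.dft F k := by
  have h1 : ∀ a : ZMod N, ∑ i, ZMod.stdAddChar (-(i * k)) • F (i + a) =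
      ZMod.stdAddChar (a * k) • ∑ i, ZMod.stdAddChar (-(i * k)) • F i := fun a => by
    rw [Finset.smul_sum, ← Equiv.sum_comp (Equiv.subRight a)]
    refine Finset.sum_congr rfl fun i _ => ?_
    rw [smul_smul, ← AddChar.map_add_eq_mul, Equiv.subRight_apply, sub_add_cancel]
    congr 2
    ring
  have h2 := h1 (-1)
  have h3 := h1 1
  simp only [← sub_eq_add_neg] at h2
  simp only [ZMod.dft_apply, smul_add, Finset.sum_add_distrib]
  rw [h2, h3, neg_one_mul, one_mul, AddChar.map_neg_eq_inv]
  module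

lemma one_ne_neg_one_and_one_ne_zero {N : ℕ} (hN : 3 ≤ N) : (1 : ZMod N) ≠ -1 ∧ (1 : ZMod N) ≠ 0 := by
  constructor
  · intro h
    have : ((2 : ℕ) : ZMod N) = 0 := by push_cast; linear_combination h
    exact absurd (Nat.le_of_dvd two_pos ((ZMod.natCast_eq_zero_iff _ _).1 this)) (by omega)
  · intro h
    have : ((1 : ℕ) : ZMod N) = 0 := by push_cast; exact h
    exact absurd (Nat.le_of_dvd one_pos ((ZMod.natCast_eq_zero_iff _ _).1 this)) (by omega)

lemma sum_sub_one_zero_one {N : ℕ} (hN : 3 ≤ N) (f : ZMod N → ℤ) (i : ZMod N) :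
    ∑ j ∈ {i - 1, i, i + 1}, f j = f (i - 1) + f i + f (i + 1) := by
  obtain ⟨h1, h0⟩ := one_ne_neg_one_and_one_ne_zero hN
  rw [Finset.sum_insert, Finset.sum_insert, Finset.sum_singleton, add_assoc]
  · simpa using h0
  · simp only [Finset.mem_insert, Finset.mem_singleton, not_or]
    refine ⟨by simpa using h0, fun h => h1 ?_⟩
    linear_combination -h

lemma neighborFinset_torusKingGraph {m n : ℕ} [NeZero m] [NeZero n] (p : ZMod m × ZMod n) :
    (torusKingGraph m n).neighborFinset p =
      (({p.1 - 1, p.1, p.1 + 1} : Finset (ZMod m)) ×ˢ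
        ({p.2 - 1, p.2, p.2 + 1} : Finset (ZMod n))).erase p := by
  have h : ∀ {N : ℕ} (a b : ZMod N),
      (a - b = -1 ∨ a - b = 0 ∨ a - b = 1) ↔ (b = a - 1 ∨ b = a ∨ b = a + 1) := fun a b => by
    have h1 : a - b = -1 ↔ b = a + 1 :=
      ⟨fun h => by linear_combination -h, fun h => by linear_combination -h⟩
    have h2 : a - b = 0 ↔ b = a := sub_eq_zero.trans eq_comm
    have h3 : a - b = 1 ↔ b = a - 1 :=
      ⟨fun h => by linear_combination -h, fun h => by linear_combination -h⟩
    rw [h1, h2, h3]; tauto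
  ext q
  rw [SimpleGraph.mem_neighborFinset]
  simp only [torusKingGraph, h, Finset.mem_erase,
    Finset.mem_product, Finset.mem_insert, Finset.mem_singleton, ne_comm]

/-- The neighbour-sum property says that each `3 × 3` block sum is twice the central entry. -/
lemma hasTorusNeighbourSum_iff {m n : ℕ} [NeZero m] [NeZero n] (hm : 3 ≤ m) (hn : 3 ≤ n)
    (X : Matrix (ZMod m) (ZMod n) ℤ) : HasTorusNeighbourSum X ↔ ∀ i j,
      (X (i - 1) (j - 1) + X i (j - 1) + X (i + 1) (j - 1)) +
      (X (i - 1) j + X i j + X (i + 1) j) +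
      (X (i - 1) (j + 1) + X i (j + 1) + X (i + 1) (j + 1)) = 2 * X i j := by
  rw [HasTorusNeighbourSum, Prod.forall]
  refine forall₂_congr fun i j => ?_
  have h := Finset.add_sum_erase
    (({i - 1, i, i + 1} : Finset (ZMod m)) ×ˢ ({j - 1, j, j + 1} : Finset (ZMod n)))
    (fun q => X q.1 q.2) (a := (i, j)) (by simp)
  rw [Finset.sum_product_right, sum_sub_one_zero_one hn, sum_sub_one_zero_one hm,
    sum_sub_one_zero_one hm, sum_sub_one_zero_one hm] at h
  rw [neighborFinset_torusKingGraph]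
  constructor <;> intro h' <;> linarith

/-- A non-trivial board with the neighbour-sum property has a nonzero Fourier coefficient. -/
lemma exists_stdAddChar_mul_eq_two {m n : ℕ} [NeZero m] [NeZero n] (hm : 3 ≤ m) (hn : 3 ≤ n)
    {X : Matrix (ZMod m) (ZMod n) ℤ} (hX : X ≠ 0) (h : HasTorusNeighbourSum X) :
    ∃ (k : ZMod m) (l : ZMod n),
      (1 + ZMod.stdAddChar k + (ZMod.stdAddChar k)⁻¹) *
        (1 + ZMod.stdAddChar l + (ZMod.stdAddChar l)⁻¹) = (2 : ℂ) := by
  rw [hasTorusNeighbourSum_iff hm hn] at h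
  let F : ZMod m → ZMod n → ℂ := fun i j => X i j
  have hF : F ≠ 0 := fun h0 => hX (by
    ext i j
    have : (X i j : ℂ) = 0 := congrFun (congrFun h0 i) j
    exact_mod_cast this)
  -- The first transform is row-valued; the second acts on its nonzero coefficient.
  obtain ⟨k, hk⟩ := Function.ne_iff.1 ((LinearEquiv.map_ne_zero_iff ZMod.dft).2 hF)
  obtain ⟨l, hl⟩ := Function.ne_iff.1 ((LinearEquiv.map_ne_zero_iff ZMod.dft).2 hk)
  refine ⟨k, l, ?_⟩
  set c : ℂ := 1 + ZMod.stdAddChar k + (ZMod.stdAddChar k)⁻¹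
  set d : ℂ := 1 + ZMod.stdAddChar l + (ZMod.stdAddChar l)⁻¹
  let T : (ZMod n → ℂ) →ₗ[ℂ] (ZMod n → ℂ) :=
    LinearMap.funLeft ℂ ℂ (· - 1) + LinearMap.id + LinearMap.funLeft ℂ ℂ (· + 1)
  have hT : ∀ i, T (F (i - 1) + F i + F (i + 1)) = (2 : ℂ) • F i := fun i => by
    ext j
    have := congrArg (Int.cast : ℤ → ℂ) (h i j)
    push_cast at this
    exact this
  have h1 : T (c • ZMod.dft F k) = (2 : ℂ) • ZMod.dft F k := by
    rw [← dft_sub_one_add_add_add_one, ZMod.dft_apply, map_sum, ZMod.dft_apply, Finset.smul_sum]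
    refine Finset.sum_congr rfl fun i _ => ?_
    rw [map_smul, hT, smul_comm]
  have h2 : ∀ G : ZMod n → ℂ, ZMod.dft (T G) l = d * ZMod.dft G l := fun G =>
    dft_sub_one_add_add_add_one G l
  have h3 := congrFun (congrArg ZMod.dft h1) l
  rw [h2, map_smul, map_smul, Pi.smul_apply, Pi.smul_apply, smul_eq_mul, smul_eq_mul,
    ← mul_assoc] at h3
  rw [mul_comm]
  exact mul_right_cancel₀ hl h3

/-! ### Explicit boards -/

lemma exists_sum_eq_of_four_dvd {m : ℕ} (h : 4 ∣ m) :
    ∃ f : ZMod m → ℤ, f 0 ≠ 0 ∧ ∀ i, f (i - 1) + f i + f (i + 1) = 1 * f i := by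
  -- `cos (π i / 2)`
  let g : ZMod 4 → ℤ := (![1, 0, -1, 0] : Fin 4 → ℤ)
  have hg : ∀ i, g (i - 1) + g i + g (i + 1) = 1 * g i := by decide
  refine ⟨fun i => g (ZMod.castHom h (ZMod 4) i), by simp [g], fun i => ?_⟩
  simp only [map_sub, map_add, map_one, hg]

lemma exists_sum_eq_of_six_dvd {m : ℕ} (h : 6 ∣ m) :
    ∃ f : ZMod m → ℤ, f 0 ≠ 0 ∧ ∀ i, f (i - 1) + f i + f (i + 1) = 2 * f i := by
  -- `2 cos (π i / 3)`
  let g : ZMod 6 → ℤ := (![2, 1, -1, -2, -1, 1] : Fin 6 → ℤ)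
  have hg : ∀ i, g (i - 1) + g i + g (i + 1) = 2 * g i := by decide
  refine ⟨fun i => g (ZMod.castHom h (ZMod 6) i), by simp [g], fun i => ?_⟩
  simp only [map_sub, map_add, map_one, hg]

lemma exists_board_of_mul_eq_two {m n : ℕ} [NeZero m] [NeZero n] (hm : 3 ≤ m) (hn : 3 ≤ n)
    {a b : ℤ} (hab : a * b = 2)
    (hf : ∃ f : ZMod m → ℤ, f 0 ≠ 0 ∧ ∀ i, f (i - 1) + f i + f (i + 1) = a * f i)
    (hg : ∃ g : ZMod n → ℤ, g 0 ≠ 0 ∧ ∀ i, g (i - 1) + g i + g (i + 1) = b * g i) :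
    ∃ X : Matrix (ZMod m) (ZMod n) ℤ, X ≠ 0 ∧ HasTorusNeighbourSum X := by
  obtain ⟨f, hf0, hf⟩ := hf
  obtain ⟨g, hg0, hg⟩ := hg
  refine ⟨Matrix.of fun i j => f i * g j, fun h => mul_ne_zero hf0 hg0 (congrFun (congrFun h 0) 0), ?_⟩
  rw [hasTorusNeighbourSum_iff hm hn]
  intro i j
  simp only [Matrix.of_apply]
  linear_combination (g (j - 1) + g j + g (j + 1)) * hf i + a * f i * hg j + f i * g j * hab

theorem mainTheorem4 (m n : ℕ) [NeZero m] [NeZero n] (hm : 3 ≤ m) (hn : 3 ≤ n) :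
    (∃ X : Matrix (ZMod m) (ZMod n) ℤ, X ≠ 0 ∧ HasTorusNeighbourSum X) ↔
      ((4 ∣ m ∧ 6 ∣ n) ∨ (6 ∣ m ∧ 4 ∣ n)) := by
  constructor
  · rintro ⟨X, hX, h⟩
    obtain ⟨k, l, hkl⟩ := exists_stdAddChar_mul_eq_two hm hn hX h
    have hpow : ∀ {N : ℕ} [NeZero N] (k : ZMod N), (ZMod.stdAddChar k : ℂ) ^ N = 1 := fun k => by
      rw [← AddChar.map_nsmul_eq_pow, nsmul_eq_mul, CharP.cast_eq_zero, zero_mul,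
        AddChar.map_zero_eq_one]
    exact dvd_of_mul_one_add_add_inv_eq_two (NeZero.ne m) (NeZero.ne n) (hpow k) (hpow l) hkl
  · rintro (⟨h4, h6⟩ | ⟨h6, h4⟩)
    · exact exists_board_of_mul_eq_two hm hn (a := 1) (b := 2) (by norm_num)
        (exists_sum_eq_of_four_dvd h4) (exists_sum_eq_of_six_dvd h6)
    · exact exists_board_of_mul_eq_two hm hn (a := 2) (b := 1) (by norm_num)
        (exists_sum_eq_of_six_dvd h6) (exists_sum_eq_of_four_dvd h4)
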